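/- Call a real $2\times2$ matrix a \emph{unimodular metric} if it is symmetric, positive definite and of determinant $1$. A \emph{deformed metric} is a function $\mathcal M$ of a real variable $w$ (ranging over $\mathbb R$ or over an interval) whose values are unimodular metrics. An $SL(2,\mathbb R)$-valued function $s$ on the same domain acts on deformed metrics by $\mathcal M(w)\mapsto s(w)\,\mathcal M(w)\,s(w)^t$ (the Geroch action). The Cholesky factor of a unimodular metric $S$ is the lower triangular matrix $L$ with positive diagonal entries and $LL^t=S$. A function $f:\mathbb R\to\mathbb C$ is a \emph{Wiener function with constant term} $c$ if $f-c$ is the Fourier transform of a function in $L^1(\mathbb R)$; a matrix valued function is a Wiener function with constant term $C$ if its entries are Wiener functions whose constant terms are the entries of $C$. A set of $SL(2,\mathbb R)$-valued functions is said to act transitively on a set $\Gamma$ of deformed metrics if it is a group under pointwise multiplication, the Geroch action of each of its elements maps $\Gamma$ into itself and defines a group action on $\Gamma$, and any $\mathcal M\in\Gamma$ can be taken to any $\mathcal M'\in\Gamma$ by some element. 1. For all real $a\le b$, the smooth functions $s:[-b,-a]\to SL(2,\mathbb R)$ act transitively on the smooth deformed metrics on $[-b,-a]$. Every such $\mathcal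 M$ has a unique pointwise Cholesky factorization $\mathcal M(w)=s(w)s(w)^t$ ($s(w)$ lower triangular with positive diagonal), and $s$ is smooth and $SL(2,\mathbb R)$-valued. The same holds with $[-b,-a]$ replaced by $\mathbb R$. 2. Sums, scalar multiples and products of Wiener functions are Wiener functions, with constant term the sum, multiple and product, respectively, of the constant terms, and a Wiener function tends to its constant term as $|w|\to\infty$. 3. Let $e_\infty$ be a unimodular metric. (a) The smooth functions $s:\mathbb R\to SL(2,\mathbb R)$ with $s-\mathbf 1=O(1/w)$ as $|w|\to\infty$ act transitively on the smooth deformed metrics $\mathcal M$ on $\mathbb R$ with $\mathcal M-e_\infty=O(1/w)$ as $|w|\to\infty$. (b) The $SL(2,\mathbb R)$-valued Wiener functions $s$ with constant term $\mathbf 1$ act transitively on the deformed metrics $\mathcal M$ on $\mathbb R$ that are Wiener functions with constant term $e_\infty$. This remains true if $s$ and $\mathcal M$ are both required in addition to be $C^\infty$, and also if both are required in addition to be real analytic. (c) Let $L_\infty$ be the (unique) Cholesky factor of $e_\infty$. Every deformed metric $\mathcal M$ that is a Wiener function with constant term $e_\infty$ has a unique pointwise Cholesky factorization $\mathcal M=LL^t$,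 and $L$ is an $SL(2,\mathbb R)$-valued Wiener function with constant term $L_\infty$. Moreover $s=LL_\infty^{-1}$ is an $SL(2,\mathbb R)$-valued Wiener function with constant term $\mathbf 1$, and $\mathcal M(w)=s(w)\,e_\infty\,s(w)^t$. -/

import Mathlib

open Matrix Filter Topology Asymptotics
open scoped ContDiff FourierTransform

/-- Real `2 × 2` matrices. -/
abbrev Mat2 : Type := Matrix (Fin 2) (Fin 2) ℝ

/-- The group `SL(2, ℝ)`. -/
abbrev SL2 : Type := Matrix.SpecialLinearGroup (Fin 2) ℝ

/-- Real, symmetric, positive definite matrices of unit determinant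
(over `ℝ`, `Matrix.PosDef` includes symmetry). -/
def IsUnimodularMetric (S : Mat2) : Prop := S.PosDef ∧ S.det = 1

/-- The Geroch action `M(w) ↦ s(w) M(w) s(w)ᵗ`. -/
def gerochAct {D : Type} (s : D → SL2) (M : D → Mat2) : D → Mat2 :=
  fun w => (s w : Mat2) * M w * (s w : Mat2)ᵀ

/-- `G` is a group under pointwise multiplication which acts, by the Geroch action,
transitively on the set `Γ` of matrix functions. -/
structure ActsTransitively {D : Type} (G : Set (D → SL2)) (Γ : Set (D → Mat2)) : Prop where
  one_mem : (1 : D → SL2) ∈ G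
  mul_mem : ∀ s ∈ G, ∀ t ∈ G, s * t ∈ G
  inv_mem : ∀ s ∈ G, s⁻¹ ∈ G
  act_mem : ∀ s ∈ G, ∀ M ∈ Γ, gerochAct s M ∈ Γ
  one_act : ∀ M ∈ Γ, gerochAct 1 M = M
  mul_act : ∀ s ∈ G, ∀ t ∈ G, ∀ M ∈ Γ, gerochAct (s * t) M = gerochAct s (gerochAct t M)
  transitive : ∀ M ∈ Γ, ∀ M' ∈ Γ, ∃ s ∈ G, gerochAct s M = M'

/-- `L` is the Cholesky factor of `S`: lower triangular with positive diagonal and `L Lᵗ = S`. -/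
structure IsCholesky (L S : Mat2) : Prop where
  lower : L 0 1 = 0
  diag_pos : ∀ i, 0 < L i i
  mul_transpose : L * Lᵀ = S

/-- Every `M ∈ Γ` has a pointwise Cholesky factorization `M = L Lᵗ`, unique among all matrix
functions, and its factor has unit determinant and belongs to the class `𝓛`. -/
def CholeskyFactorsIn {D : Type} (Γ : Set (D → Mat2)) (𝓛 : Set (D → SL2)) : Prop :=
  ∀ M ∈ Γ, ∃ L ∈ 𝓛, (∀ w, IsCholesky (L w : Mat2) (M w)) ∧
    ∀ L' : D → Mat2, (∀ w, IsCholesky (L' w) (M w)) → ∀ w, L' w = (L w : Mat2)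

/-! ### Smooth functions on a segment -/

/-- A function given on the segment `[p, q]` is smooth (one-sidedly at the end points). -/
def SmoothOnSegment {p q : ℝ} (f : Set.Icc p q → ℝ) : Prop :=
  ∃ F : ℝ → ℝ, ContDiffOn ℝ ∞ F (Set.Icc p q) ∧ ∀ w : Set.Icc p q, F w = f w

/-- The Geroch group for the axis segment `a ≤ t ≤ b`: smooth `s : [-b, -a] → SL(2, ℝ)`. -/
def segmentGroup (a b : ℝ) : Set (Set.Icc (-b) (-a) → SL2) :=
  {s | ∀ i j, SmoothOnSegment fun w => (s w : Mat2) i j}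

/-- Smooth deformed metrics `M(w)` on `a ≤ -w ≤ b`. -/
def segmentMetrics (a b : ℝ) : Set (Set.Icc (-b) (-a) → Mat2) :=
  {M | (∀ w, IsUnimodularMetric (M w)) ∧ ∀ i j, SmoothOnSegment fun w => M w i j}

/-! ### Functions on the whole line -/

/-- Entries of class `C^n` on the real line (`n = ∞`: smooth; `n = ω`: real analytic). -/
def IsOfClass (n : WithTop ℕ∞) (A : ℝ → Mat2) : Prop :=
  ∀ i j, ContDiff ℝ n fun w => A w i j

/-- `SL(2, ℝ)` valued functions on the line, of class `C^n`. -/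
def lineGroup (n : WithTop ℕ∞) : Set (ℝ → SL2) :=
  {s | IsOfClass n fun w => (s w : Mat2)}

/-- Deformed metrics on the line, of class `C^n`. -/
def lineMetrics (n : WithTop ℕ∞) : Set (ℝ → Mat2) :=
  {M | (∀ w, IsUnimodularMetric (M w)) ∧ IsOfClass n M}

/-- `A - C` falls off as `1/w` or faster as `|w| → ∞`. -/
def FallsOffTo (A : ℝ → Mat2) (C : Mat2) : Prop :=
  ∀ i j, (fun w => A w i j - C i j) =O[cocompact ℝ] fun w : ℝ => w⁻¹

/-- `SL(2, ℝ)` valued functions `s` such that `s - 1` falls off as `1/w` or faster. -/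
def falloffGroup : Set (ℝ → SL2) :=
  {s | FallsOffTo (fun w => (s w : Mat2)) 1}

/-- Deformed metrics `M` such that `M - e` falls off as `1/w` or faster. -/
def falloffMetrics (e : Mat2) : Set (ℝ → Mat2) :=
  {M | (∀ w, IsUnimodularMetric (M w)) ∧ FallsOffTo M e}

/-- `f` is a Wiener function with constant term `c`: the sum of `c` and the Fourier transform of
an absolutely integrable function. -/
def IsWiener (f : ℝ → ℂ) (c : ℂ) : Prop :=
  ∃ g : ℝ → ℂ, MeasureTheory.Integrable g ∧ ∀ w, f w = c + 𝓕 g w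

/-- The entries of `A` are Wiener functions whose constant terms are the entries of `C`. -/
def IsWienerMatrix (A : ℝ → Mat2) (C : Mat2) : Prop :=
  ∀ i j, IsWiener (fun w => (A w i j : ℂ)) (C i j : ℂ)

/-- `SL(2, ℝ)` valued Wiener functions with constant term `C`. -/
def wienerFunctions (C : SL2) : Set (ℝ → SL2) :=
  {s | IsWienerMatrix (fun w => (s w : Mat2)) (C : Mat2)}

/-- The asymptotic-flatness-preserving Geroch group in the Wiener sense: constant term `1`. -/
def wienerGroup : Set (ℝ → SL2) := wienerFunctions 1

/-- Wiener function deformed metrics with constant term `e`. -/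
def wienerMetrics (e : Mat2) : Set (ℝ → Mat2) :=
  {M | (∀ w, IsUnimodularMetric (M w)) ∧ IsWienerMatrix M e}

/-!
The Cholesky factor of a unimodular metric `S` is a polynomial in the entries of `S` and in
`(S 0 0) ^ (± 1 / 2)`. So if `M = L Lᵗ` and `M' = L' L'ᵗ` have entries in a class of functions
closed under sums, products and inverse square roots of positive functions, then so do `L` and
`L'`, and `L' L⁻¹` takes `M` to `M'`.

For Wiener functions, closure under inverse square roots is of Wiener–Lévy type. Write `f` as
`c + φ` with `φ` a Schwartz function, plus a remainder of small Wiener norm. Two derivatives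
control the `L¹` norm of a Fourier transform, so the Wiener norm of `(c + φ) ^ n` is at most a
quadratic polynomial in `n` times `(sup |c + φ|) ^ n`; with the binomial theorem the norm of
`f ^ n` is `O(q ^ n)` for every `q > sup |f|`. Hence a power series can be composed with `f` as soon
as a smaller concentric disc contains the range of `f`, and a compact set in the open right half
plane lies in a disc whose closure is contained in that half plane.
-/

open MeasureTheory

/-! ### The Wiener algebra -/

theorem integral_norm_convolution_le {𝕜 G A : Type*} [NontriviallyNormedField 𝕜] [NormedRing A]
    [NormedAlgebra 𝕜 A] [NormedSpace ℝ A] [AddGroup G] [MeasurableSpace G] [MeasurableAdd₂ G]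
    [MeasurableNeg G] {μ : Measure G} [SFinite μ] [μ.IsAddRightInvariant] {g h : G → A}
    (hg : Integrable g μ) (hh : Integrable h μ) :
    ∫ x, ‖convolution g h (ContinuousLinearMap.mul 𝕜 A) μ x‖ ∂μ ≤
      (∫ x, ‖g x‖ ∂μ) * ∫ x, ‖h x‖ ∂μ := by
  have hgh := hg.norm.integrable_convolution (ContinuousLinearMap.mul ℝ ℝ) hh.norm
  refine (integral_mono_ae (hg.integrable_convolution _ hh).norm hgh ?_).trans_eq
    (integral_convolution (ContinuousLinearMap.mul ℝ ℝ) hg.norm hh.norm)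
  filter_upwards [hg.norm.ae_convolution_exists (ContinuousLinearMap.mul ℝ ℝ) hh.norm] with x hx
  exact norm_integral_le_of_norm_le hx (.of_forall fun t => norm_mul_le _ _)

theorem exists_fourierTransformCLM_eq_mul {V A : Type*} [NormedAddCommGroup V]
    [InnerProductSpace ℝ V] [FiniteDimensional ℝ V] [MeasurableSpace V] [BorelSpace V]
    [NormedRing A] [NormedAlgebra ℂ A] [CompleteSpace A] (g h : V →₁[volume] A) :
    ∃ k : V →₁[volume] A, ‖k‖ ≤ ‖g‖ * ‖h‖ ∧ ∀ w, Real.Lp.fourierTransformCLM V A k w =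
      Real.Lp.fourierTransformCLM V A g w * Real.Lp.fourierTransformCLM V A h w := by
  have hg := L1.integrable_coeFn g
  have hh := L1.integrable_coeFn h
  have hk := hg.integrable_convolution (ContinuousLinearMap.mul ℂ A) hh
  refine ⟨hk.toL1 _, ?_, fun w => ?_⟩
  · rw [L1.norm_of_fun_eq_integral_norm, L1.norm_eq_integral_norm, L1.norm_eq_integral_norm]
    exact integral_norm_convolution_le hg hh
  · simp only [Real.Lp.fourierTransformCLM_apply, Real.Lp.fourierTransform_apply]
    rw [← Real.fourier_mul_convolution_eq hg hh]
    exact Real.fourier_congr_ae hk.coeFn_toL1 w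

/-- `f` is a Wiener function with constant term `c`, whose norm in the Wiener algebra (the modulus
of the constant term plus the `L¹` norm of the inverse Fourier transform of `f - c`) is at most
`K`. Bounding the norm instead of defining it avoids choosing that inverse transform. -/
def WienerNormLE (f : ℝ → ℂ) (c : ℂ) (K : ℝ) : Prop :=
  ∃ g : ℝ →₁[volume] ℂ, (∀ w, f w = c + Real.Lp.fourierTransformCLM ℝ ℂ g w) ∧ ‖c‖ + ‖g‖ ≤ K

namespace WienerNormLE

variable {f f₁ f₂ : ℝ → ℂ} {c c₁ c₂ : ℂ} {K K₁ K₂ : ℝ}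

theorem isWiener (h : WienerNormLE f c K) : IsWiener f c :=
  let ⟨g, hf, _⟩ := h
  ⟨g, L1.integrable_coeFn g, hf⟩

theorem of_integrable {g : ℝ → ℂ} (hg : Integrable g) (hf : ∀ w, f w = c + 𝓕 g w) :
    WienerNormLE f c (‖c‖ + ∫ x, ‖g x‖) :=
  ⟨hg.toL1 g, fun w => (hf w).trans (congrArg (c + ·) (Real.fourier_congr_ae hg.coeFn_toL1 w).symm),
    by rw [L1.norm_of_fun_eq_integral_norm]⟩

theorem mono (h : WienerNormLE f c K₁) (hK : K₁ ≤ K₂) : WienerNormLE f c K₂ :=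
  let ⟨g, hf, hn⟩ := h
  ⟨g, hf, hn.trans hK⟩

theorem nonneg (h : WienerNormLE f c K) : 0 ≤ K :=
  let ⟨_, _, hn⟩ := h
  le_trans (by positivity) hn

theorem norm_le (h : WienerNormLE f c K) (w : ℝ) : ‖f w‖ ≤ K := by
  obtain ⟨g, hf, hn⟩ := h
  have hgw : ‖Real.Lp.fourierTransformCLM ℝ ℂ g w‖ ≤ ‖g‖ := by
    rw [L1.norm_eq_integral_norm]
    exact VectorFourier.norm_fourierIntegral_le_integral_norm _ _ _ _ _
  calc ‖f w‖ ≤ ‖c‖ + ‖Real.Lp.fourierTransformCLM ℝ ℂ g w‖ := hf w ▸ norm_add_le _ _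
    _ ≤ K := (add_le_add_right hgw _).trans hn

theorem const (c : ℂ) : WienerNormLE (fun _ => c) c ‖c‖ :=
  ⟨0, fun w => by rw [map_zero, BoundedContinuousFunction.coe_zero, Pi.zero_apply, add_zero],
    by rw [norm_zero, add_zero]⟩

theorem add (h₁ : WienerNormLE f₁ c₁ K₁) (h₂ : WienerNormLE f₂ c₂ K₂) :
    WienerNormLE (fun w => f₁ w + f₂ w) (c₁ + c₂) (K₁ + K₂) := by
  obtain ⟨g₁, hf₁, hn₁⟩ := h₁
  obtain ⟨g₂, hf₂, hn₂⟩ := h₂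
  refine ⟨g₁ + g₂, fun w => ?_, ?_⟩
  · simp only [hf₁, hf₂, map_add, BoundedContinuousFunction.add_apply, add_add_add_comm]
  · linarith [norm_add_le c₁ c₂, norm_add_le g₁ g₂]

theorem mul (h₁ : WienerNormLE f₁ c₁ K₁) (h₂ : WienerNormLE f₂ c₂ K₂) :
    WienerNormLE (fun w => f₁ w * f₂ w) (c₁ * c₂) (K₁ * K₂) := by
  have hK₁ := h₁.nonneg
  obtain ⟨g₁, hf₁, hn₁⟩ := h₁
  obtain ⟨g₂, hf₂, hn₂⟩ := h₂
  obtain ⟨g₁₂, hn₁₂, hg₁₂⟩ := exists_fourierTransformCLM_eq_mul g₁ g₂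
  refine ⟨c₁ • g₂ + c₂ • g₁ + g₁₂, fun w => ?_, ?_⟩
  · simp only [hf₁, hf₂, map_add, map_smul, BoundedContinuousFunction.add_apply,
      BoundedContinuousFunction.smul_apply, hg₁₂, smul_eq_mul]
    ring
  · calc ‖c₁ * c₂‖ + ‖c₁ • g₂ + c₂ • g₁ + g₁₂‖
        ≤ ‖c₁‖ * ‖c₂‖ + (‖c₁‖ * ‖g₂‖ + ‖c₂‖ * ‖g₁‖ + ‖g₁‖ * ‖g₂‖) := by
          rw [norm_mul, ← norm_smul c₁ g₂, ← norm_smul c₂ g₁]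
          gcongr
          exact norm_add₃_le.trans (by gcongr)
      _ = (‖c₁‖ + ‖g₁‖) * (‖c₂‖ + ‖g₂‖) := by ring
      _ ≤ K₁ * K₂ := mul_le_mul hn₁ hn₂ (by positivity) hK₁

theorem const_mul (h : WienerNormLE f c K) (k : ℂ) :
    WienerNormLE (fun w => k * f w) (k * c) (‖k‖ * K) :=
  (const k).mul h

theorem pow (h : WienerNormLE f c K) (n : ℕ) :
    WienerNormLE (fun w => f w ^ n) (c ^ n) (K ^ n) := by
  induction n with
  | zero => simpa only [pow_zero, norm_one] using const 1
  | succ n ih => simpa only [pow_succ] using ih.mul h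

section Sums

variable {ι : Type*} {F : ι → ℝ → ℂ} {C : ι → ℂ} {B : ι → ℝ}

theorem sum (s : Finset ι) (h : ∀ i ∈ s, WienerNormLE (F i) (C i) (B i)) :
    WienerNormLE (fun w => ∑ i ∈ s, F i w) (∑ i ∈ s, C i) (∑ i ∈ s, B i) := by
  classical
  induction s using Finset.induction_on with
  | empty => simpa only [Finset.sum_empty, norm_zero] using const 0
  | insert i s hi ih =>
    simp only [Finset.sum_insert hi]
    exact (h i (s.mem_insert_self i)).add (ih fun j hj => h j (Finset.mem_insert_of_mem hj))

theorem tsum (h : ∀ i, WienerNormLE (F i) (C i) (B i)) (hB : Summable B) :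
    WienerNormLE (fun w => ∑' i, F i w) (∑' i, C i) (∑' i, B i) := by
  choose g hF hn using h
  have hC : Summable fun i => ‖C i‖ := hB.of_nonneg_of_le (fun i => norm_nonneg _) fun i => by
    linarith [hn i, norm_nonneg (g i)]
  have hg : Summable fun i => ‖g i‖ := hB.of_nonneg_of_le (fun i => norm_nonneg _) fun i => by
    linarith [hn i, norm_nonneg (C i)]
  refine ⟨∑' i, g i, fun w => ?_, ?_⟩
  · have hgw := hg.of_norm.hasSum.mapL
      (BoundedContinuousFunction.evalCLM ℂ w ∘L Real.Lp.fourierTransformCLM ℝ ℂ)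
    simp only [hF]
    exact (hC.of_norm.hasSum.add hgw).tsum_eq
  · calc ‖∑' i, C i‖ + ‖∑' i, g i‖ ≤ ∑' i, (‖C i‖ + ‖g i‖) := by
          rw [hC.tsum_add hg]
          exact add_le_add (norm_tsum_le_tsum_norm hC) (norm_tsum_le_tsum_norm hg)
      _ ≤ ∑' i, B i := (hC.add hg).tsum_le_tsum hn hB

end Sums

end WienerNormLE

namespace IsWiener

variable {f g : ℝ → ℂ} {c d : ℂ}

theorem exists_wienerNormLE (h : IsWiener f c) : ∃ K, WienerNormLE f c K :=
  let ⟨_, hg, hf⟩ := h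
  ⟨_, .of_integrable hg hf⟩

theorem const (c : ℂ) : IsWiener (fun _ => c) c :=
  (WienerNormLE.const c).isWiener

theorem add (hf : IsWiener f c) (hg : IsWiener g d) : IsWiener (fun w => f w + g w) (c + d) :=
  let ⟨_, hf⟩ := hf.exists_wienerNormLE
  let ⟨_, hg⟩ := hg.exists_wienerNormLE
  (hf.add hg).isWiener

theorem mul (hf : IsWiener f c) (hg : IsWiener g d) : IsWiener (fun w => f w * g w) (c * d) :=
  let ⟨_, hf⟩ := hf.exists_wienerNormLE
  let ⟨_, hg⟩ := hg.exists_wienerNormLE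
  (hf.mul hg).isWiener

theorem const_mul (hf : IsWiener f c) (k : ℂ) : IsWiener (fun w => k * f w) (k * c) :=
  (IsWiener.const k).mul hf

theorem sub_const (hf : IsWiener f c) (k : ℂ) : IsWiener (fun w => f w - k) (c - k) := by
  simpa only [sub_eq_add_neg] using hf.add (.const (-k))

theorem tendsto (h : IsWiener f c) : Tendsto f (cocompact ℝ) (𝓝 c) := by
  obtain ⟨g, -, hf⟩ := h
  rw [funext hf]
  simpa only [add_zero] using (Real.zero_at_infty_fourier g).const_add c

theorem continuous (h : IsWiener f c) : Continuous f := by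
  obtain ⟨_, g, hf, -⟩ := h.exists_wienerNormLE
  rw [funext hf]
  exact continuous_const.add (Real.Lp.fourierTransformCLM ℝ ℂ g).continuous

theorem norm_const_le {ρ : ℝ} (h : IsWiener f c) (hf : ∀ w, ‖f w‖ ≤ ρ) : ‖c‖ ≤ ρ :=
  le_of_tendsto h.tendsto.norm (.of_forall hf)

theorem exists_schwartz_sub {ε : ℝ} (h : IsWiener f c) (hε : 0 < ε) :
    ∃ φ : SchwartzMap ℝ ℂ, WienerNormLE (fun w => f w - (c + φ w)) 0 ε := by
  obtain ⟨_, g, hf, -⟩ := h.exists_wienerNormLE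
  obtain ⟨k, hk⟩ := (SchwartzMap.denseRange_toLpCLM ENNReal.one_ne_top).exists_dist_lt g hε
  have h𝓕k (w : ℝ) : Real.Lp.fourierTransformCLM ℝ ℂ (k.toLp 1 volume) w = (𝓕 k) w := by
    rw [SchwartzMap.fourier_coe]
    exact Real.fourier_congr_ae (k.coeFn_toLp 1 volume) w
  refine ⟨𝓕 k, g - k.toLp 1 volume, fun w => ?_, ?_⟩
  · simp only [hf, map_sub, BoundedContinuousFunction.sub_apply, h𝓕k]
    ring
  · rw [norm_zero, zero_add, ← dist_eq_norm]
    exact hk.le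

end IsWiener

/-! ### Powers of Wiener functions -/

theorem norm_pow_sub_pow_le {A : Type*} [NormedCommRing A] [NormOneClass A] {a b : A} {R : ℝ}
    (ha : ‖a‖ ≤ R) (hb : ‖b‖ ≤ R) (n : ℕ) : ‖a ^ n - b ^ n‖ ≤ n * R ^ (n - 1) * ‖a - b‖ := by
  have hterm : ∀ i ∈ Finset.range n, ‖a ^ i * b ^ (n - 1 - i)‖ ≤ R ^ (n - 1) := fun i hi => by
    have hR : 0 ≤ R := (norm_nonneg a).trans ha
    rw [← Nat.add_sub_of_le (Nat.le_sub_one_of_lt (Finset.mem_range.1 hi)), pow_add,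
      Nat.add_sub_cancel_left]
    exact (norm_mul_le _ _).trans (mul_le_mul ((norm_pow_le a i).trans (by gcongr))
      ((norm_pow_le b _).trans (by gcongr)) (norm_nonneg _) (by positivity))
  rw [← geom_sum₂_mul]
  refine (norm_mul_le _ _).trans (mul_le_mul_of_nonneg_right ?_ (norm_nonneg _))
  simpa only [Finset.card_range, nsmul_eq_mul] using
    (norm_sum_le_of_le _ hterm).trans_eq (Finset.sum_const _)

theorem exists_descFactorial_mul_pow_sub_le (k : ℕ) {R q : ℝ} (hR : 0 ≤ R) (hRq : R < q) :
    ∃ B, ∀ n : ℕ, n.descFactorial k * R ^ (n - k) ≤ B * q ^ n := by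
  have hq : 0 < q := hR.trans_lt hRq
  have hRq' : ‖R / q‖ < 1 := by rwa [Real.norm_of_nonneg (by positivity), div_lt_one hq]
  obtain ⟨B, hB⟩ :=
    (summable_descFactorial_mul_geometric_of_norm_lt_one k hRq').tendsto_atTop_zero.bddAbove_range
  have hB (n : ℕ) : ((n + k).descFactorial k : ℝ) * (R / q) ^ n ≤ B := hB ⟨n, rfl⟩
  have hB₀ : 0 ≤ B := le_trans (by positivity) (hB 0)
  refine ⟨B / q ^ k, fun n => ?_⟩
  rcases lt_or_ge n k with hn | hn
  · rw [Nat.descFactorial_eq_zero_iff_lt.2 hn, Nat.cast_zero, zero_mul]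
    positivity
  · obtain ⟨m, rfl⟩ := Nat.exists_eq_add_of_le' hn
    calc ((m + k).descFactorial k : ℝ) * R ^ (m + k - k)
        = (m + k).descFactorial k * (R / q) ^ m * q ^ m := by
          rw [Nat.add_sub_cancel, div_pow, mul_assoc, div_mul_cancel₀ _ (by positivity)]
      _ ≤ B * q ^ m := by gcongr; exact hB m
      _ = B / q ^ k * q ^ (m + k) := by rw [pow_add]; field_simp

theorem norm_fourier_le_mul_inv_one_add_sq {E : Type*} [NormedAddCommGroup E] [NormedSpace ℂ E]
    {ψ ψ' ψ'' : ℝ → E} (hψ : ∀ x, HasDerivAt ψ (ψ' x) x) (hψ' : ∀ x, HasDerivAt ψ' (ψ'' x) x)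
    (i₀ : Integrable ψ) (i₁ : Integrable ψ') (i₂ : Integrable ψ'') (x : ℝ) :
    ‖𝓕 ψ x‖ ≤ ((∫ y, ‖ψ y‖) + ∫ y, ‖ψ'' y‖) * (1 + x ^ 2)⁻¹ := by
  obtain rfl : ψ' = deriv ψ := funext fun y => (hψ y).deriv.symm
  obtain rfl : ψ'' = deriv (deriv ψ) := funext fun y => (hψ' y).deriv.symm
  have h𝓕 : 𝓕 (deriv (deriv ψ)) x = (2 * Real.pi * Complex.I * x) ^ 2 • 𝓕 ψ x := by
    rw [Real.fourier_deriv i₁ (fun y => (hψ' y).differentiableAt) i₂,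
      Real.fourier_deriv i₀ (fun y => (hψ y).differentiableAt) i₁]
    simp only [smul_smul, sq]
  have hnorm : ‖(2 * Real.pi * Complex.I * x : ℂ) ^ 2‖ = (2 * Real.pi) ^ 2 * x ^ 2 := by
    simp [mul_pow, sq_abs]
  have b₀ : ‖𝓕 ψ x‖ ≤ ∫ y, ‖ψ y‖ :=
    VectorFourier.norm_fourierIntegral_le_integral_norm _ _ _ _ _
  have b₂ : ‖𝓕 (deriv (deriv ψ)) x‖ ≤ ∫ y, ‖deriv (deriv ψ) y‖ :=
    VectorFourier.norm_fourierIntegral_le_integral_norm _ _ _ _ _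
  rw [h𝓕, norm_smul, hnorm] at b₂
  have hx : x ^ 2 ≤ (2 * Real.pi) ^ 2 * x ^ 2 :=
    le_mul_of_one_le_left (sq_nonneg x) (one_le_pow₀ (by linarith [Real.pi_gt_three]))
  rw [← div_eq_mul_inv, le_div_iff₀ (by positivity), mul_add, mul_one, mul_comm _ (x ^ 2)]
  exact add_le_add b₀ ((mul_le_mul_of_nonneg_right hx (norm_nonneg _)).trans b₂)

namespace WienerNormLE

theorem of_hasDerivAt {ψ ψ' ψ'' : ℝ → ℂ} (hψ : ∀ x, HasDerivAt ψ (ψ' x) x)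
    (hψ' : ∀ x, HasDerivAt ψ' (ψ'' x) x) (i₀ : Integrable ψ) (i₁ : Integrable ψ')
    (i₂ : Integrable ψ'') :
    WienerNormLE ψ 0 (((∫ y, ‖ψ y‖) + ∫ y, ‖ψ'' y‖) * Real.pi) := by
  have hcont : Continuous ψ := continuous_iff_continuousAt.2 fun x => (hψ x).continuousAt
  have h𝓕cont : Continuous (𝓕 ψ) := VectorFourier.fourierIntegral_continuous
    Real.continuous_fourierChar (L := innerₗ ℝ) (by fun_prop) i₀
  have hle := norm_fourier_le_mul_inv_one_add_sq hψ hψ' i₀ i₁ i₂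
  have hdom := integrable_inv_one_add_sq.const_mul ((∫ y, ‖ψ y‖) + ∫ y, ‖ψ'' y‖)
  have h𝓕 : Integrable (𝓕 ψ) := hdom.mono' h𝓕cont.aestronglyMeasurable (.of_forall hle)
  have hinv : 𝓕⁻ ψ = fun x => 𝓕 ψ (-x) := funext (Real.fourierInv_eq_fourier_neg ψ)
  refine (of_integrable (g := 𝓕⁻ ψ) (hinv ▸ h𝓕.comp_neg) fun w => ?_).mono ?_
  · rw [hcont.fourier_fourierInv_eq i₀ h𝓕, zero_add]
  · rw [norm_zero, zero_add, hinv, integral_neg_eq_self fun x => ‖𝓕 ψ x‖,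
      ← integral_univ_inv_one_add_sq, ← integral_const_mul]
    exact integral_mono h𝓕.norm hdom hle

theorem of_hasDerivAt_of_norm_le {ψ ψ' ψ'' : ℝ → ℂ} {b₀ b₁ b₂ : ℝ → ℝ}
    (hψ : ∀ x, HasDerivAt ψ (ψ' x) x) (hψ' : ∀ x, HasDerivAt ψ' (ψ'' x) x)
    (i₀ : Integrable b₀) (i₁ : Integrable b₁) (i₂ : Integrable b₂)
    (h₀ : ∀ x, ‖ψ x‖ ≤ b₀ x) (h₁ : ∀ x, ‖ψ' x‖ ≤ b₁ x) (h₂ : ∀ x, ‖ψ'' x‖ ≤ b₂ x) :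
    WienerNormLE ψ 0 (((∫ x, b₀ x) + ∫ x, b₂ x) * Real.pi) := by
  have m₀ : Continuous ψ := continuous_iff_continuousAt.2 fun x => (hψ x).continuousAt
  have m₁ : Continuous ψ' := continuous_iff_continuousAt.2 fun x => (hψ' x).continuousAt
  have m₂ : StronglyMeasurable ψ'' :=
    (funext fun x => (hψ' x).deriv : deriv ψ' = ψ'') ▸ stronglyMeasurable_deriv ψ'
  have j₀ := i₀.mono' m₀.aestronglyMeasurable (.of_forall h₀)
  have j₂ := i₂.mono' m₂.aestronglyMeasurable (.of_forall h₂)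
  refine (of_hasDerivAt hψ hψ' j₀ (i₁.mono' m₁.aestronglyMeasurable (.of_forall h₁)) j₂).mono ?_
  exact mul_le_mul_of_nonneg_right (add_le_add (integral_mono j₀.norm i₀ h₀)
    (integral_mono j₂.norm i₂ h₂)) Real.pi_nonneg

section ConstAddPow

variable {φ φ' φ'' : ℝ → ℂ} {c : ℂ} {R : ℝ}

theorem const_add_pow (hφ : ∀ x, HasDerivAt φ (φ' x) x) (hφ' : ∀ x, HasDerivAt φ' (φ'' x) x)
    (i₀ : Integrable φ) (i₁ : Integrable φ') (i₁₁ : Integrable fun x => ‖φ' x‖ ^ 2)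
    (i₂ : Integrable φ'') (hc : ‖c‖ ≤ R) (hle : ∀ x, ‖c + φ x‖ ≤ R) (n : ℕ) :
    WienerNormLE (fun x => (c + φ x) ^ n) (c ^ n)
      (R ^ n + (n * R ^ (n - 1) * (∫ x, ‖φ x‖) + (n * (n - 1 : ℕ) * R ^ (n - 2) *
        (∫ x, ‖φ' x‖ ^ 2) + n * R ^ (n - 1) * ∫ x, ‖φ'' x‖)) * Real.pi) := by
  have h₀ (x : ℝ) : ‖(c + φ x) ^ n - c ^ n‖ ≤ n * R ^ (n - 1) * ‖φ x‖ := by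
    simpa only [add_sub_cancel_left] using norm_pow_sub_pow_le (hle x) hc n
  have h₁ (y : ℂ) (x : ℝ) : ‖n * (c + φ x) ^ (n - 1) * y‖ ≤ n * R ^ (n - 1) * ‖y‖ := by
    rw [norm_mul, norm_mul, norm_pow, Complex.norm_natCast]
    gcongr
    exact hle x
  have h₂ (y : ℂ) (x : ℝ) : ‖n * ((n - 1 : ℕ) * (c + φ x) ^ (n - 2) * y) * y‖ ≤
      n * (n - 1 : ℕ) * R ^ (n - 2) * ‖y‖ ^ 2 := by
    simp only [norm_mul, norm_pow, Complex.norm_natCast]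
    calc (n * ((n - 1 : ℕ) * ‖c + φ x‖ ^ (n - 2) * ‖y‖) * ‖y‖ : ℝ)
        = n * (n - 1 : ℕ) * ‖c + φ x‖ ^ (n - 2) * ‖y‖ ^ 2 := by ring
      _ ≤ n * (n - 1 : ℕ) * R ^ (n - 2) * ‖y‖ ^ 2 := by gcongr; exact hle x
  have key := of_hasDerivAt_of_norm_le (ψ := fun x => (c + φ x) ^ n - c ^ n)
    (fun x => (((hφ x).const_add c).pow n).sub_const _)
    (fun x => ((((hφ x).const_add c).pow (n - 1)).const_mul (n : ℂ)).mul (hφ' x))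
    (i₀.norm.const_mul _) (i₁.norm.const_mul _)
    ((i₁₁.const_mul (n * (n - 1 : ℕ) * R ^ (n - 2))).add (i₂.norm.const_mul (n * R ^ (n - 1))))
    h₀ (fun x => h₁ _ x) fun x => norm_add_le_of_le (h₂ _ x) (h₁ _ x)
  rw [integral_const_mul, integral_add' (i₁₁.const_mul _) (i₂.norm.const_mul _),
    integral_const_mul, integral_const_mul] at key
  simpa only [add_sub_cancel, add_zero] using ((const (c ^ n)).add key).mono
    (add_le_add_left ((norm_pow_le c n).trans (pow_le_pow_left₀ (norm_nonneg c) hc n)) _)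

theorem exists_const_add_pow {q : ℝ}
    (hφ : ∀ x, HasDerivAt φ (φ' x) x) (hφ' : ∀ x, HasDerivAt φ' (φ'' x) x)
    (i₀ : Integrable φ) (i₁ : Integrable φ') (i₁₁ : Integrable fun x => ‖φ' x‖ ^ 2)
    (i₂ : Integrable φ'') (hc : ‖c‖ ≤ R) (hle : ∀ x, ‖c + φ x‖ ≤ R) (hRq : R < q) :
    ∃ C, ∀ n : ℕ, WienerNormLE (fun x => (c + φ x) ^ n) (c ^ n) (C * q ^ n) := by
  have hR : 0 ≤ R := (norm_nonneg c).trans hc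
  obtain ⟨B₁, hB₁⟩ := exists_descFactorial_mul_pow_sub_le 1 hR hRq
  obtain ⟨B₂, hB₂⟩ := exists_descFactorial_mul_pow_sub_le 2 hR hRq
  refine ⟨1 + (B₁ * (∫ x, ‖φ x‖) + (B₂ * (∫ x, ‖φ' x‖ ^ 2) + B₁ * ∫ x, ‖φ'' x‖)) * Real.pi,
    fun n => (const_add_pow hφ hφ' i₀ i₁ i₁₁ i₂ hc hle n).mono ?_⟩
  have h₁ : n * R ^ (n - 1) ≤ B₁ * q ^ n := by
    simpa only [Nat.descFactorial_one] using hB₁ n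
  have h₂ : n * (n - 1 : ℕ) * R ^ (n - 2) ≤ B₂ * q ^ n := by
    have := hB₂ n
    rwa [Nat.descFactorial_succ, Nat.descFactorial_one, mul_comm (n - 1), Nat.cast_mul] at this
  calc R ^ n + (n * R ^ (n - 1) * (∫ x, ‖φ x‖) + (n * (n - 1 : ℕ) * R ^ (n - 2) *
        (∫ x, ‖φ' x‖ ^ 2) + n * R ^ (n - 1) * ∫ x, ‖φ'' x‖)) * Real.pi
      ≤ q ^ n + (B₁ * q ^ n * (∫ x, ‖φ x‖) + (B₂ * q ^ n * (∫ x, ‖φ' x‖ ^ 2) +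
        B₁ * q ^ n * ∫ x, ‖φ'' x‖)) * Real.pi := by gcongr
    _ = _ := by ring

end ConstAddPow

theorem add_pow {h r : ℝ → ℂ} {c d : ℂ} {C R ε : ℝ}
    (hh : ∀ n : ℕ, WienerNormLE (fun w => h w ^ n) (c ^ n) (C * R ^ n))
    (hr : WienerNormLE r d ε) (n : ℕ) :
    WienerNormLE (fun w => (h w + r w) ^ n) ((c + d) ^ n) (C * (R + ε) ^ n) := by
  have key := sum (Finset.range (n + 1)) fun m _ =>
    ((hh m).mul (hr.pow (n - m))).mul (const (n.choose m : ℂ))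
  simp only [← _root_.add_pow, Complex.norm_natCast] at key
  refine key.mono (le_of_eq ?_)
  simp only [_root_.add_pow, Finset.mul_sum, mul_assoc]

end WienerNormLE

theorem IsWiener.exists_wienerNormLE_pow {f : ℝ → ℂ} {c : ℂ} {ρ q : ℝ} (h : IsWiener f c)
    (hf : ∀ w, ‖f w‖ ≤ ρ) (hρq : ρ < q) :
    ∃ C, ∀ n : ℕ, WienerNormLE (fun w => f w ^ n) (c ^ n) (C * q ^ n) := by
  obtain ⟨ε, hε, hq⟩ : ∃ ε > 0, ρ + ε + ε + ε = q :=
    ⟨(q - ρ) / 3, by linarith, by ring⟩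
  obtain ⟨φ, hφ⟩ := h.exists_schwartz_sub hε
  have hle (w : ℝ) : ‖c + φ w‖ ≤ ρ + ε := by
    rw [← sub_sub_cancel (f w) (c + φ w)]
    exact (norm_sub_le _ _).trans (add_le_add (hf w) (hφ.norm_le w))
  let φ' := SchwartzMap.derivCLM ℂ ℂ φ
  have hφ'sq : Integrable fun x => ‖φ' x‖ ^ 2 := (φ'.memLp 2 volume).integrable_norm_pow two_ne_zero
  obtain ⟨C, hC⟩ := WienerNormLE.exists_const_add_pow (φ' := φ') φ.hasDerivAt φ'.hasDerivAt
    φ.integrable φ'.integrable hφ'sq (SchwartzMap.derivCLM ℂ ℂ φ').integrable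
    ((h.norm_const_le hf).trans (by linarith)) hle (lt_add_of_pos_right _ hε)
  refine ⟨C, fun n => ?_⟩
  simpa only [add_sub_cancel, add_zero, hq] using WienerNormLE.add_pow hC hφ n

/-! ### Analytic functions of Wiener functions -/

theorem IsWiener.comp_hasFPowerSeriesOnBall {F : ℂ → ℂ} {p : FormalMultilinearSeries ℂ ℂ ℂ}
    {z₀ : ℂ} {r : ENNReal} {f : ℝ → ℂ} {c : ℂ} {ρ : ℝ} (h : IsWiener f c)
    (hF : HasFPowerSeriesOnBall F p z₀ r) (hf : ∀ w, ‖f w - z₀‖ ≤ ρ)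
    (hρ : ENNReal.ofReal ρ < r) :
    IsWiener (fun w => F (f w)) (F c) := by
  obtain ⟨q, hρq, hqr⟩ := ENNReal.lt_iff_exists_nnreal_btwn.1 hρ
  obtain ⟨C, hpow⟩ := (h.sub_const z₀).exists_wienerNormLE_pow hf
    (Real.toNNReal_lt_iff_lt_coe ((norm_nonneg _).trans (hf 0)) |>.1 (ENNReal.coe_lt_coe.1 hρq))
  have hF_eq (z : ℂ) (hz : ‖z - z₀‖ ≤ ρ) : F z = ∑' n, p.coeff n * (z - z₀) ^ n := by
    have hz' : z - z₀ ∈ Metric.eball (0 : ℂ) r := by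
      rw [Metric.mem_eball, edist_zero_right, ← ofReal_norm]
      exact (ENNReal.ofReal_le_ofReal hz).trans_lt hρ
    have hsum := (hF.hasSum hz').tsum_eq
    simp only [FormalMultilinearSeries.apply_eq_pow_smul_coeff, smul_eq_mul,
      add_sub_cancel] at hsum
    simp only [← hsum, mul_comm]
  have hsummable : Summable fun n => ‖p.coeff n‖ * (C * (q : ℝ) ^ n) := by
    have hp := (p.summable_norm_mul_pow (hqr.trans_le hF.r_le)).mul_left C
    simpa only [p.norm_apply_eq_norm_coef, mul_left_comm] using hp
  have key := WienerNormLE.tsum (fun n => (hpow n).const_mul (p.coeff n)) hsummable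
  simpa only [← hF_eq _ (hf _), ← hF_eq c ((h.sub_const z₀).norm_const_le hf)] using key.isWiener

theorem exists_pos_forall_le_of_tendsto_cocompact {α : Type*} [TopologicalSpace α] {f : α → ℝ}
    {c : ℝ} (hcont : Continuous f) (hf : ∀ w, 0 < f w) (hc : 0 < c)
    (hlim : Tendsto f (cocompact α) (𝓝 c)) :
    ∃ m, 0 < m ∧ ∀ w, m ≤ f w := by
  obtain ⟨K, hK, hKf⟩ :=
    mem_cocompact.1 (hlim.eventually (lt_mem_nhds (half_lt_self hc)))
  rcases K.eq_empty_or_nonempty with rfl | hne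
  · exact ⟨c / 2, half_pos hc, fun w => (hKf (Set.notMem_empty w)).le⟩
  · obtain ⟨x, -, hx⟩ := hK.exists_isMinOn hne hcont.continuousOn
    refine ⟨min (c / 2) (f x), lt_min (half_pos hc) (hf x), fun w => ?_⟩
    by_cases hw : w ∈ K
    · exact (min_le_right _ _).trans (hx hw)
    · exact (min_le_left _ _).trans (hKf hw).le

theorem exists_lt_forall_norm_sub_le_of_le_re {m : ℝ} (hm : 0 < m) (B : ℝ) :
    ∃ K ρ : ℝ, ρ < K ∧ ∀ z : ℂ, m ≤ z.re → ‖z‖ ≤ B → ‖z - K‖ ≤ ρ := by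
  obtain ⟨K, hK, hKm⟩ : ∃ K : ℝ, 0 < K ∧ 2 * K * m = B ^ 2 + 1 :=
    ⟨(B ^ 2 + 1) / (2 * m), by positivity, by field_simp⟩
  refine ⟨K, √(K ^ 2 - 1), (Real.sqrt_lt' hK).2 (by linarith), fun z hz hB => ?_⟩
  refine Real.le_sqrt_of_sq_le ?_
  calc ‖z - K‖ ^ 2 = ‖z‖ ^ 2 - 2 * K * z.re + K ^ 2 := by
        simp only [← Complex.normSq_eq_norm_sq, Complex.normSq_apply, Complex.sub_re,
          Complex.sub_im, Complex.ofReal_re, Complex.ofReal_im]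
        ring
    _ ≤ B ^ 2 - 2 * K * m + K ^ 2 := by gcongr
    _ = K ^ 2 - 1 := by rw [hKm]; ring

namespace IsWiener

theorem comp_of_re_pos {F : ℂ → ℂ} {f : ℝ → ℂ} {c : ℂ} (h : IsWiener f c)
    (hF : DifferentiableOn ℂ F {z | 0 < z.re}) (hf : ∀ w, 0 < (f w).re) (hc : 0 < c.re) :
    IsWiener (fun w => F (f w)) (F c) := by
  obtain ⟨m, hm, hmf⟩ := exists_pos_forall_le_of_tendsto_cocompact
    (Complex.continuous_re.comp h.continuous) hf hc
    ((Complex.continuous_re.tendsto c).comp h.tendsto)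
  obtain ⟨B, hB⟩ := h.exists_wienerNormLE
  obtain ⟨K, ρ, hρK, hdisc⟩ := exists_lt_forall_norm_sub_le_of_le_re hm B
  have hfρ (w : ℝ) : ‖f w - K‖ ≤ ρ := hdisc _ (hmf w) (hB.norm_le w)
  obtain ⟨t, hρt, htK⟩ := exists_between hρK
  have ht : 0 < t := ((norm_nonneg _).trans (hfρ 0)).trans_lt hρt
  lift t to NNReal using ht.le
  have hball : Metric.closedBall (K : ℂ) t ⊆ {z | 0 < z.re} := fun z hz => by
    have hre : |z.re - K| ≤ t := by
      simpa only [Complex.sub_re, Complex.ofReal_re] using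
        (Complex.abs_re_le_norm _).trans (mem_closedBall_iff_norm.1 hz)
    exact Set.mem_ofPred.2 (by linarith [neg_abs_le (z.re - K)])
  refine h.comp_hasFPowerSeriesOnBall ((hF.mono hball).hasFPowerSeriesOnBall ht) hfρ ?_
  rwa [← ENNReal.ofReal_coe_nnreal, ENNReal.ofReal_lt_ofReal_iff ht]

theorem inv_sqrt {f : ℝ → ℝ} {c : ℝ} (h : IsWiener (fun w => (f w : ℂ)) c)
    (hf : ∀ w, 0 < f w) (hc : 0 < c) :
    IsWiener (fun w => (((√(f w))⁻¹ : ℝ) : ℂ)) (((√c)⁻¹ : ℝ) : ℂ) := by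
  have hcpow (x : ℝ) (hx : 0 < x) : (x : ℂ) ^ ((-(1 / 2) : ℝ) : ℂ) = ((√x)⁻¹ : ℝ) := by
    rw [← Complex.ofReal_cpow hx.le, Real.rpow_neg hx.le, Real.sqrt_eq_rpow]
  have hF : DifferentiableOn ℂ (fun z : ℂ => z ^ ((-(1 / 2) : ℝ) : ℂ)) {z | 0 < z.re} :=
    differentiableOn_id.cpow_const fun z hz => .inl hz
  simpa only [hcpow _ (hf _), hcpow c hc] using h.comp_of_re_pos hF hf hc

end IsWiener

/-! ### Cholesky factors of unimodular metrics -/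

namespace IsUnimodularMetric

variable {S : Mat2}

theorem apply_zero_one (h : IsUnimodularMetric S) : S 0 1 = S 1 0 := by
  simpa only [star_trivial] using h.1.isHermitian.apply 1 0

theorem apply_zero_zero_pos (h : IsUnimodularMetric S) : 0 < S 0 0 :=
  h.1.diag_pos

theorem apply_mul_apply_sub (h : IsUnimodularMetric S) : S 0 0 * S 1 1 - S 1 0 * S 1 0 = 1 := by
  rw [← h.2, Matrix.det_fin_two, h.apply_zero_one]

theorem one : IsUnimodularMetric 1 :=
  ⟨Matrix.PosDef.one, Matrix.det_one⟩

theorem mul_mul_transpose (h : IsUnimodularMetric S) (A : SL2) :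
    IsUnimodularMetric ((A : Mat2) * S * (A : Mat2)ᵀ) := by
  have hA : IsUnit (A : Mat2) := by
    rw [Matrix.isUnit_iff_isUnit_det, A.det_coe]
    exact isUnit_one
  refine ⟨?_, by simp only [Matrix.det_mul, Matrix.det_transpose, A.det_coe, h.2, mul_one]⟩
  rw [← Matrix.conjTranspose_eq_transpose_of_trivial]
  exact h.1.mul_mul_conjTranspose_same (Matrix.vecMul_injective_of_isUnit hA)

/-- The Cholesky factor of a unimodular metric `S`. Since `S 0 0 * S 1 1 - S 1 0 ^ 2 = 1`, its
entries involve only the first column of `S`. -/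
noncomputable def choleskyFactor (h : IsUnimodularMetric S) : SL2 :=
  ⟨!![√(S 0 0), 0; S 1 0 * (√(S 0 0))⁻¹, (√(S 0 0))⁻¹], by
    rw [Matrix.det_fin_two_of, mul_inv_cancel₀ (Real.sqrt_pos.2 h.apply_zero_zero_pos).ne',
      zero_mul, sub_zero]⟩

theorem isCholesky_choleskyFactor (h : IsUnimodularMetric S) :
    IsCholesky (h.choleskyFactor : Mat2) S := by
  have hs : 0 < √(S 0 0) := Real.sqrt_pos.2 h.apply_zero_zero_pos
  have hs_sq : √(S 0 0) * √(S 0 0) = S 0 0 := Real.mul_self_sqrt h.apply_zero_zero_pos.le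
  have h₁₁ : S 1 0 * (√(S 0 0))⁻¹ * (S 1 0 * (√(S 0 0))⁻¹) + (√(S 0 0))⁻¹ * (√(S 0 0))⁻¹ =
      S 1 1 := by
    rw [mul_mul_mul_comm, ← mul_inv, hs_sq, ← add_one_mul, ← h.apply_mul_apply_sub,
      add_sub_cancel, mul_comm (S 0 0), mul_inv_cancel_right₀ h.apply_zero_zero_pos.ne']
  refine ⟨rfl, Fin.forall_fin_two.2 ⟨hs, inv_pos.2 hs⟩, ?_⟩
  calc (h.choleskyFactor : Mat2) * (h.choleskyFactor : Mat2)ᵀ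
      = !![√(S 0 0), 0; S 1 0 * (√(S 0 0))⁻¹, (√(S 0 0))⁻¹] *
          !![√(S 0 0), S 1 0 * (√(S 0 0))⁻¹; 0, (√(S 0 0))⁻¹] :=
        congrArg _ (Matrix.eta_fin_two _)
    _ = !![S 0 0, S 0 1; S 1 0, S 1 1] := by
        simp only [Matrix.mul_fin_two, hs_sq, h₁₁, h.apply_zero_one, mul_left_comm (√(S 0 0)),
          mul_zero, zero_mul, add_zero, inv_mul_cancel_right₀ hs.ne', mul_inv_cancel₀ hs.ne',
          mul_one]
    _ = S := (Matrix.eta_fin_two S).symm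

end IsUnimodularMetric

theorem IsCholesky.unique {L L' S : Mat2} (h : IsCholesky L S) (h' : IsCholesky L' S) :
    L = L' := by
  have h_mul (i j : Fin 2) :
      L i 0 * L j 0 + L i 1 * L j 1 = L' i 0 * L' j 0 + L' i 1 * L' j 1 := by
    simpa only [Matrix.mul_apply, Fin.sum_univ_two, Matrix.transpose_apply] using
      congrFun₂ (h.mul_transpose.trans h'.mul_transpose.symm) i j
  simp only [Fin.forall_fin_two, h.lower, h'.lower, mul_zero, zero_mul, add_zero] at h_mul
  obtain ⟨⟨h_mul₀₀, -⟩, h_mul₁₀, h_mul₁₁⟩ := h_mul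
  have h₀₀ : L 0 0 = L' 0 0 := (mul_self_inj (h.diag_pos 0).le (h'.diag_pos 0).le).1 h_mul₀₀
  have h₁₀ : L 1 0 = L' 1 0 := mul_right_cancel₀ (h.diag_pos 0).ne' (h_mul₁₀.trans (h₀₀ ▸ rfl))
  have h₁₁ : L 1 1 = L' 1 1 := by
    rw [h₁₀, add_right_inj] at h_mul₁₁
    exact (mul_self_inj (h.diag_pos 1).le (h'.diag_pos 1).le).1 h_mul₁₁
  rw [Matrix.eta_fin_two L, Matrix.eta_fin_two L', h₀₀, h.lower, h'.lower, h₁₀, h₁₁]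

section GerochAct

variable {D : Type}

theorem gerochAct_one (M : D → Mat2) : gerochAct 1 M = M := by
  ext1 w
  simp only [gerochAct, Pi.one_apply, Matrix.SpecialLinearGroup.coe_one, Matrix.transpose_one,
    Matrix.one_mul, Matrix.mul_one]

theorem gerochAct_mul (s t : D → SL2) (M : D → Mat2) :
    gerochAct (s * t) M = gerochAct s (gerochAct t M) := by
  ext1 w
  simp only [gerochAct, Pi.mul_apply, Matrix.SpecialLinearGroup.coe_mul, Matrix.transpose_mul,
    Matrix.mul_assoc]

theorem gerochAct_one_right (s : D → SL2) :
    gerochAct s 1 = fun w => (s w : Mat2) * (s w : Mat2)ᵀ := by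
  ext1 w
  rw [gerochAct, Pi.one_apply, Matrix.mul_one]

theorem gerochAct_mul_inv {L L' : D → SL2} {M M' : D → Mat2}
    (hL : ∀ w, IsCholesky (L w : Mat2) (M w)) (hL' : ∀ w, IsCholesky (L' w : Mat2) (M' w)) :
    gerochAct (L' * L⁻¹) M = M' := by
  have hM : gerochAct L 1 = M :=
    (gerochAct_one_right L).trans (funext fun w => (hL w).mul_transpose)
  have hM' : gerochAct L' 1 = M' :=
    (gerochAct_one_right L').trans (funext fun w => (hL' w).mul_transpose)
  rw [← hM, ← hM', ← gerochAct_mul, inv_mul_cancel_right]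

end GerochAct

/-! ### Classes of coefficient functions -/

/-- A class of real functions `f`, each with a constant term `c`, which contains the constants and
is closed under sums, products and inverse square roots of positive functions. A class without an
asymptotic condition is a predicate that ignores `c`. -/
structure IsCoefficientClass {D : Type} (P : (D → ℝ) → ℝ → Prop) : Prop where
  const : ∀ c, P (fun _ => c) c
  add : ∀ {f g c d}, P f c → P g d → P (fun w => f w + g w) (c + d)
  mul : ∀ {f g c d}, P f c → P g d → P (fun w => f w * g w) (c * d)
  inv_sqrt : ∀ {f c}, P f c → (∀ w, 0 < f w) → 0 < c → P (fun w => (√(f w))⁻¹) (√c)⁻¹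

/-- `SL(2, ℝ)` valued functions with entries in the class `P`, with constant term `C`. -/
def classFunctions {D : Type} (P : (D → ℝ) → ℝ → Prop) (C : SL2) : Set (D → SL2) :=
  {s | ∀ i j, P (fun w => (s w : Mat2) i j) ((C : Mat2) i j)}

/-- Deformed metrics with entries in the class `P`, with constant term `e`. -/
def classMetrics {D : Type} (P : (D → ℝ) → ℝ → Prop) (e : Mat2) : Set (D → Mat2) :=
  {M | (∀ w, IsUnimodularMetric (M w)) ∧ ∀ i j, P (fun w => M w i j) (e i j)}

theorem classFunctions_and {D : Type} (P Q : (D → ℝ) → ℝ → Prop) (C : SL2) :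
    classFunctions (fun f c => P f c ∧ Q f c) C = classFunctions P C ∩ classFunctions Q C :=
  Set.ext fun _ => by simp only [classFunctions, Set.mem_inter_iff, Set.mem_ofPred_eq, forall_and]

theorem classMetrics_and {D : Type} (P Q : (D → ℝ) → ℝ → Prop) (e : Mat2) :
    classMetrics (fun f c => P f c ∧ Q f c) e = classMetrics P e ∩ classMetrics Q e :=
  Set.ext fun _ => by
    simp only [classMetrics, Set.mem_inter_iff, Set.mem_ofPred_eq, forall_and]
    exact and_and_left

namespace IsCoefficientClass

variable {D : Type} {P Q : (D → ℝ) → ℝ → Prop}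

theorem neg (hP : IsCoefficientClass P) {f : D → ℝ} {c : ℝ} (hf : P f c) :
    P (fun w => -f w) (-c) := by
  simpa only [neg_one_mul] using hP.mul (hP.const (-1)) hf

theorem sqrt (hP : IsCoefficientClass P) {f : D → ℝ} {c : ℝ} (hf : P f c) (h : ∀ w, 0 < f w)
    (hc : 0 < c) : P (fun w => √(f w)) (√c) := by
  simpa only [← div_eq_mul_inv, Real.div_sqrt] using hP.mul hf (hP.inv_sqrt hf h hc)

theorem and (hP : IsCoefficientClass P) (hQ : IsCoefficientClass Q) :
    IsCoefficientClass fun f c => P f c ∧ Q f c where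
  const c := ⟨hP.const c, hQ.const c⟩
  add hf hg := ⟨hP.add hf.1 hg.1, hQ.add hf.2 hg.2⟩
  mul hf hg := ⟨hP.mul hf.1 hg.1, hQ.mul hf.2 hg.2⟩
  inv_sqrt hf h hc := ⟨hP.inv_sqrt hf.1 h hc, hQ.inv_sqrt hf.2 h hc⟩

theorem matrix_mul (hP : IsCoefficientClass P) {A B : D → Mat2} {C E : Mat2}
    (hA : ∀ i j, P (fun w => A w i j) (C i j)) (hB : ∀ i j, P (fun w => B w i j) (E i j))
    (i j : Fin 2) : P (fun w => (A w * B w) i j) ((C * E) i j) := by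
  simp only [Matrix.mul_apply, Fin.sum_univ_two]
  exact hP.add (hP.mul (hA i 0) (hB 0 j)) (hP.mul (hA i 1) (hB 1 j))

theorem const_mem (hP : IsCoefficientClass P) (C : SL2) : (fun _ => C) ∈ classFunctions P C :=
  fun _ _ => hP.const _

theorem mul_mem (hP : IsCoefficientClass P) {s t : D → SL2} {C E : SL2}
    (hs : s ∈ classFunctions P C) (ht : t ∈ classFunctions P E) :
    s * t ∈ classFunctions P (C * E) := fun i j => by
  simpa only [Pi.mul_apply, Matrix.SpecialLinearGroup.coe_mul] using hP.matrix_mul hs ht i j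

theorem inv_mem (hP : IsCoefficientClass P) {s : D → SL2} {C : SL2}
    (hs : s ∈ classFunctions P C) : s⁻¹ ∈ classFunctions P C⁻¹ := fun i j => by
  simp only [Pi.inv_apply, Matrix.SpecialLinearGroup.coe_inv, Matrix.adjugate_fin_two]
  fin_cases i <;> fin_cases j
  exacts [hs 1 1, hP.neg (hs 0 1), hP.neg (hs 1 0), hs 0 0]

theorem mul_inv_mem (hP : IsCoefficientClass P) {s t : D → SL2} {C : SL2}
    (hs : s ∈ classFunctions P C) (ht : t ∈ classFunctions P C) :
    s * t⁻¹ ∈ classFunctions P 1 :=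
  mul_inv_cancel C ▸ hP.mul_mem hs (hP.inv_mem ht)

theorem gerochAct_mem (hP : IsCoefficientClass P) {s : D → SL2} {C : SL2} {M : D → Mat2}
    {e : Mat2} (hs : s ∈ classFunctions P C) (hM : M ∈ classMetrics P e) :
    gerochAct s M ∈ classMetrics P ((C : Mat2) * e * (C : Mat2)ᵀ) :=
  ⟨fun w => (hM.1 w).mul_mul_transpose (s w),
    hP.matrix_mul (hP.matrix_mul hs hM.2) fun i j => hs j i⟩

theorem choleskyFactor_mem (hP : IsCoefficientClass P) {M : D → Mat2} {e : Mat2}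
    (hM : M ∈ classMetrics P e) (he : IsUnimodularMetric e) :
    (fun w => (hM.1 w).choleskyFactor) ∈ classFunctions P he.choleskyFactor := fun i j => by
  have hpos (w : D) : 0 < M w 0 0 := (hM.1 w).apply_zero_zero_pos
  have h := hP.inv_sqrt (hM.2 0 0) hpos he.apply_zero_zero_pos
  fin_cases i <;> fin_cases j
  exacts [hP.sqrt (hM.2 0 0) hpos he.apply_zero_zero_pos, hP.const 0, hP.mul (hM.2 1 0) h, h]

theorem mem_of_isCholesky (hP : IsCoefficientClass P) {M : D → Mat2} {e : Mat2}
    (hM : M ∈ classMetrics P e) (he : IsUnimodularMetric e) {L : D → SL2}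
    (hL : ∀ w, IsCholesky (L w : Mat2) (M w)) : L ∈ classFunctions P he.choleskyFactor := by
  obtain rfl : L = fun w => (hM.1 w).choleskyFactor :=
    funext fun w => Subtype.ext ((hL w).unique (hM.1 w).isCholesky_choleskyFactor)
  exact hP.choleskyFactor_mem hM he

theorem choleskyFactorsIn (hP : IsCoefficientClass P) {e : Mat2} (he : IsUnimodularMetric e) :
    CholeskyFactorsIn (classMetrics P e) (classFunctions P he.choleskyFactor) := fun _ hM =>
  ⟨_, hP.choleskyFactor_mem hM he, fun w => (hM.1 w).isCholesky_choleskyFactor,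
    fun _ hL' w => (hL' w).unique (hM.1 w).isCholesky_choleskyFactor⟩

theorem actsTransitively (hP : IsCoefficientClass P) {e : Mat2} (he : IsUnimodularMetric e) :
    ActsTransitively (classFunctions P 1) (classMetrics P e) where
  one_mem := hP.const_mem 1
  mul_mem s hs t ht := by simpa only [mul_one] using hP.mul_mem hs ht
  inv_mem s hs := by simpa only [inv_one] using hP.inv_mem hs
  act_mem s hs M hM := by
    simpa only [Matrix.SpecialLinearGroup.coe_one, Matrix.transpose_one, Matrix.one_mul,
      Matrix.mul_one] using hP.gerochAct_mem hs hM
  one_act M _ := gerochAct_one M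
  mul_act s _ t _ M _ := gerochAct_mul s t M
  transitive M hM M' hM' := by
    obtain ⟨L, hL, hLM, -⟩ := hP.choleskyFactorsIn he M hM
    obtain ⟨L', hL', hLM', -⟩ := hP.choleskyFactorsIn he M' hM'
    exact ⟨L' * L⁻¹, hP.mul_inv_mem hL' hL, gerochAct_mul_inv hLM hLM'⟩

theorem actsTransitively_inter (hP : IsCoefficientClass P) (hQ : IsCoefficientClass Q)
    {e : Mat2} (he : IsUnimodularMetric e) :
    ActsTransitively (classFunctions P 1 ∩ classFunctions Q 1)
      (classMetrics P e ∩ classMetrics Q e) := by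
  rw [← classFunctions_and, ← classMetrics_and]
  exact (hP.and hQ).actsTransitively he

end IsCoefficientClass

theorem isCoefficientClass_smoothOnSegment (p q : ℝ) :
    IsCoefficientClass fun (f : Set.Icc p q → ℝ) (_ : ℝ) => SmoothOnSegment f where
  const c := ⟨fun _ => c, contDiffOn_const, fun _ => rfl⟩
  add := fun ⟨F, hF, hf⟩ ⟨G, hG, hg⟩ =>
    ⟨fun w => F w + G w, hF.add hG, fun w => by simp only [hf, hg]⟩
  mul := fun ⟨F, hF, hf⟩ ⟨G, hG, hg⟩ =>
    ⟨fun w => F w * G w, hF.mul hG, fun w => by simp only [hf, hg]⟩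
  inv_sqrt := fun ⟨F, hF, hf⟩ h _ => by
    have hpos : ∀ w ∈ Set.Icc p q, 0 < F w := fun w hw => (hf ⟨w, hw⟩).symm ▸ h ⟨w, hw⟩
    exact ⟨fun w => (√(F w))⁻¹, (hF.sqrt fun w hw => (hpos w hw).ne').inv
      fun w hw => (Real.sqrt_pos.2 (hpos w hw)).ne', fun w => by simp only [hf]⟩

theorem isCoefficientClass_contDiff (n : WithTop ℕ∞) :
    IsCoefficientClass fun (f : ℝ → ℝ) (_ : ℝ) => ContDiff ℝ n f where
  const _ := contDiff_const
  add hf hg := hf.add hg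
  mul hf hg := hf.mul hg
  inv_sqrt hf h _ := (hf.sqrt fun w => (h w).ne').inv fun w => (Real.sqrt_pos.2 (h w)).ne'

theorem isCoefficientClass_sub_isBigO {D : Type} {l : Filter D} {u : D → ℝ}
    (hu : Tendsto u l (𝓝 0)) :
    IsCoefficientClass fun (f : D → ℝ) (c : ℝ) => (fun w => f w - c) =O[l] u where
  const c := by simpa only [sub_self] using isBigO_zero u l
  add hf hg := (hf.add hg).congr_left fun w => by ring
  mul {f g c d} hf hg := by
    have hg_one : g =O[l] fun _ => (1 : ℝ) :=
      (tendsto_sub_nhds_zero_iff.1 (hg.trans_tendsto hu)).isBigO_one ℝ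
    have hfg : (fun w => (f w - c) * g w) =O[l] u := by
      simpa only [mul_one] using hf.mul hg_one
    exact (hfg.add (hg.const_mul_left c)).congr_left fun w => by ring
  inv_sqrt {f c} hf _ hc := by
    have hd : DifferentiableAt ℝ (fun x : ℝ => (√x)⁻¹) c :=
      (differentiableAt_id.sqrt hc.ne').inv (Real.sqrt_pos.2 hc).ne'
    exact (hd.isBigO_sub.comp_tendsto
      (tendsto_sub_nhds_zero_iff.1 (hf.trans_tendsto hu))).trans hf

theorem isCoefficientClass_falloff :
    IsCoefficientClass fun (f : ℝ → ℝ) (c : ℝ) =>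
      (fun w => f w - c) =O[cocompact ℝ] fun w : ℝ => w⁻¹ :=
  isCoefficientClass_sub_isBigO
    (tendsto_inv₀_cobounded.mono_left (Metric.cobounded_eq_cocompact (α := ℝ)).ge)

theorem isCoefficientClass_isWiener :
    IsCoefficientClass fun (f : ℝ → ℝ) (c : ℝ) => IsWiener (fun w => (f w : ℂ)) (c : ℂ) where
  const c := .const c
  add hf hg := by simpa only [Complex.ofReal_add] using IsWiener.add hf hg
  mul hf hg := by simpa only [Complex.ofReal_mul] using IsWiener.mul hf hg
  inv_sqrt hf h hc := IsWiener.inv_sqrt hf h hc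

theorem mainTheorem7 :
    -- smooth deformed metrics on a segment, and on the whole line
    (∀ a b : ℝ, a ≤ b →
      ActsTransitively (segmentGroup a b) (segmentMetrics a b) ∧
      CholeskyFactorsIn (segmentMetrics a b) (segmentGroup a b)) ∧
    (ActsTransitively (lineGroup ∞) (lineMetrics ∞) ∧
      CholeskyFactorsIn (lineMetrics ∞) (lineGroup ∞)) ∧
    -- Wiener functions form an algebra and tend to their constant terms
    (∀ (f g : ℝ → ℂ) (c d : ℂ), IsWiener f c → IsWiener g d →
      IsWiener (fun w => f w + g w) (c + d) ∧
      (∀ k : ℂ, IsWiener (fun w => k * f w) (k * c)) ∧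
      IsWiener (fun w => f w * g w) (c * d) ∧
      Tendsto f (cocompact ℝ) (𝓝 c)) ∧
    -- asymptotically flat deformed metrics with a common asymptotic value
    (∀ e : Mat2, IsUnimodularMetric e →
      -- `1/w` falloff
      ActsTransitively (lineGroup ∞ ∩ falloffGroup) (lineMetrics ∞ ∩ falloffMetrics e) ∧
      -- Wiener functions; smooth Wiener functions; real analytic Wiener functions
      ActsTransitively wienerGroup (wienerMetrics e) ∧
      ActsTransitively (lineGroup ∞ ∩ wienerGroup) (lineMetrics ∞ ∩ wienerMetrics e) ∧
      ActsTransitively (lineGroup ω ∩ wienerGroup) (lineMetrics ω ∩ wienerMetrics e) ∧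
      -- the Cholesky factor of a Wiener deformed metric is a Wiener function whose constant
      -- term is the Cholesky factor of the asymptotic value
      ∃ C : SL2, IsCholesky (C : Mat2) e ∧
        (∀ C' : Mat2, IsCholesky C' e → C' = (C : Mat2)) ∧
        CholeskyFactorsIn (wienerMetrics e) (wienerFunctions C) ∧
        ∀ M ∈ wienerMetrics e, ∀ L : ℝ → SL2, (∀ w, IsCholesky (L w : Mat2) (M w)) →
          (fun w => L w * C⁻¹) ∈ wienerGroup ∧
          M = gerochAct (fun w => L w * C⁻¹) (fun _ => e)) := by
  have hS a b := isCoefficientClass_smoothOnSegment (-b) (-a)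
  have hD := isCoefficientClass_contDiff
  have hF := isCoefficientClass_falloff
  have hW := isCoefficientClass_isWiener
  have h1 := IsUnimodularMetric.one
  refine ⟨fun a b _ => ⟨(hS a b).actsTransitively h1, (hS a b).choleskyFactorsIn h1⟩,
    ⟨(hD ∞).actsTransitively h1, (hD ∞).choleskyFactorsIn h1⟩,
    fun f g c d hf hg => ⟨hf.add hg, hf.const_mul, hf.mul hg, hf.tendsto⟩,
    fun e he => ⟨(hD ∞).actsTransitively_inter hF he, hW.actsTransitively he,
      (hD ∞).actsTransitively_inter hW he, (hD ω).actsTransitively_inter hW he, ?_⟩⟩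
  have hC := he.isCholesky_choleskyFactor
  exact ⟨he.choleskyFactor, hC, fun C' hC' => hC'.unique hC, hW.choleskyFactorsIn he,
    fun M hM L hL => ⟨hW.mul_inv_mem (hW.mem_of_isCholesky hM he hL) (hW.const_mem _),
      (gerochAct_mul_inv (fun _ => hC) hL).symm⟩⟩
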